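/- Conventions. A propositional language L is a set of connectives with finite arities (arity 0 allowed); L-formulas are built from the variables x_0, x_1, … . Σ_L is the monoid (under composition) of substitutions, i.e. endomorphisms of the term algebra of L-formulas. A sequent is a pair Γ ⇒ Δ of finite sequences of formulas, not both empty; its type is (|Γ|,|Δ|). A deductive system S = ⟨S, ⊢⟩ over L consists of a set S of sequents that contains, with one sequent, all sequents of the same type, and a consequence relation ⊢ on S with: X ⊢ u implies σX ⊢ σu for every σ ∈ Σ_L. Put γ(X) = {u ∈ S : X ⊢ u}, and let ℘(S)_γ = γ[℘(S)] be the left module over the quantale ℘(Σ_L) with joins γ(⋃ X_i) and scalar multiplication A·_γ X = γ({σu : σ ∈ A, u ∈ X}). If h : ℘(Σ_L) → ℘(Σ_{L'}) is a homomorphism of unital quantales and N a ℘(Σ_{L'})-module, then N_h is the ℘(Σ_L)-module on the sup-lattice N with a·x := h(a)·x. For languages L, L', a *translation* is a homomorphism of unital quantales h : ℘(Σ_L) → ℘(Σ_{L'}) such that (i) h maps completely join-prime elements (i.e. singletons) to completely join-prime elements; (ii) if Y is completely join-prime with YY = Y, then XX = X for every completely join-prime X with h(X) = Y; (iii) h^{-1}(R)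 = {R} for each set R of substitutions that map variables to variables, where such substitutions of the two languages are identified when they act in the same way on the variables. For a monoid homomorphism h_0 : Σ_L → Σ_{L'}, write ℘(h_0) for the quantale homomorphism X ↦ h_0[X]. Deductive systems S = ⟨S, ⊢_S⟩ over L and T = ⟨T, ⊢_T⟩ over L' are *equivalent via* monoid homomorphisms h_0 : Σ_L → Σ_{L'} and k_0 : Σ_{L'} → Σ_L if there are maps ι : S → ℘(T) and ι' : T → ℘(S) with ι(σu) = h_0(σ)ι(u) and ι'(ρv) = k_0(ρ)ι'(v) for all σ, u, ρ, v; with X ⊢_S u iff ι[X] ⊢_T ι(u), and Y ⊢_T v iff ι'[Y] ⊢_S ι'(v), where ι[X] = ⋃_{x∈X} ι(x) and likewise for ι'; and with v ⊣⊢_T ι[ι'(v)] for all v ∈ T. **Theorem.** Let S = ⟨S, ⊢_γ⟩ and T = ⟨T, ⊢_δ⟩ be deductive systems over propositional languages L and L', with associated closure operators γ and δ, and let h : ℘(Σ_L) → ℘(Σ_{L'}) be a surjective translation. Then the following are equivalent: (a) S and T are equivalent via h, i.e. h = ℘(h_0) and S and T are equivalent via h_0 and k_0 for some monoid homomorphisms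 h_0 : Σ_L → Σ_{L'} and k_0 : Σ_{L'} → Σ_L; (b) as (a), where moreover k_0 can be chosen such that ℘(k_0) is a translation; (c) ℘(S)_γ and (℘(T)_δ)_h are isomorphic ℘(Σ_L)-modules. -/

import Mathlib

open scoped Pointwise

universe u v

namespace PropLogic

/-! ### Consequence relations on sets with a monoid action -/

/-- An abstract consequence relation over a set `S`. -/
structure ConsequenceRelation (S : Type*) where
  /-- `rel X u` means that `u` follows from the set of premisses `X`. -/
  rel : Set S → S → Prop
  refl : ∀ (X : Set S) (u : S), u ∈ X → rel X u
  mono : ∀ (X Y : Set S) (u : S), rel X u → X ⊆ Y → rel Y u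
  cut : ∀ (X Y : Set S) (u : S), rel Y u → (∀ v ∈ Y, rel X v) → rel X u

/-- `X ⊢ Y`: every element of `Y` follows from `X`. -/
def ConsequenceRelation.entails {S : Type*} (c : ConsequenceRelation S) (X Y : Set S) : Prop :=
  ∀ v ∈ Y, c.rel X v

/-- Invariance of a consequence relation under the action of a monoid. -/
def ConsequenceRelation.ActionInvariant (A : Type*) {S : Type*} [Monoid A] [MulAction A S]
    (c : ConsequenceRelation S) : Prop :=
  ∀ (a : A) (X : Set S) (u : S), c.rel X u → c.rel ((fun x => a • x) '' X) (a • u)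

/-- The extension `X ↦ ι[X]`, the union of the sets `ι x` for `x ∈ X`. -/
def setExtend {S T : Type*} (i : S → Set T) (X : Set S) : Set T :=
  ⋃ x ∈ X, i x

/-- A weak representation of one consequence relation in another one. -/
def IsWeakRepresentation {S T : Type*} (c : ConsequenceRelation S) (d : ConsequenceRelation T)
    (i : S → Set T) : Prop :=
  ∀ (X : Set S) (u : S), c.rel X u ↔ d.entails (setExtend i X) (i u)

/-- A similarity: two weak representations with `v ⊣⊢ ι[ι'(v)]` for all `v`. -/
def IsSimilarity {S T : Type*} (c : ConsequenceRelation S) (d : ConsequenceRelation T)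
    (i : S → Set T) (j : T → Set S) : Prop :=
  IsWeakRepresentation c d i ∧ IsWeakRepresentation d c j ∧
    ∀ v : T, d.entails {v} (setExtend i (j v)) ∧ d.entails (setExtend i (j v)) {v}

/-- A map `S → ℘(T)` that is action-invariant via a monoid homomorphism. -/
def ActionInvariantVia {A B S T : Type*} [Monoid A] [Monoid B] [MulAction A S] [MulAction B T]
    (h : A →* B) (i : S → Set T) : Prop :=
  ∀ (a : A) (x : S), i (a • x) = (fun t => h a • t) '' i x

/-- The two consequence relations are equivalent via the monoid homomorphisms `h` and `k`. -/
def EquivalentViaPair {A B S T : Type*} [Monoid A] [Monoid B] [MulAction A S] [MulAction B T]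
    (c : ConsequenceRelation S) (d : ConsequenceRelation T) (h : A →* B) (k : B →* A) : Prop :=
  ∃ (i : S → Set T) (j : T → Set S),
    IsSimilarity c d i j ∧ ActionInvariantVia h i ∧ ActionInvariantVia k j

/-! ### Quantales and quantale modules

A unital quantale is a `Monoid` and a `CompleteLattice` with Mathlib's `IsQuantale`. -/

/-- Homomorphisms of unital quantales: monoid homomorphisms that preserve arbitrary joins. -/
structure QuantaleHom (Q R : Type*) [Monoid Q] [CompleteLattice Q] [IsQuantale Q]
    [Monoid R] [CompleteLattice R] [IsQuantale R] extends Q →* R where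
  map_sSup' : ∀ X : Set Q, toFun (sSup X) = sSup (toFun '' X)

instance {Q R : Type*} [Monoid Q] [CompleteLattice Q] [IsQuantale Q]
    [Monoid R] [CompleteLattice R] [IsQuantale R] :
    CoeFun (QuantaleHom Q R) (fun _ => Q → R) :=
  ⟨fun h => h.toMonoidHom⟩

/-- Left modules over a unital quantale. -/
class QuantaleModule (Q M : Type*) [Monoid Q] [CompleteLattice Q] [IsQuantale Q]
    [CompleteLattice M] extends MulAction Q M where
  smul_sSup' : ∀ (a : Q) (X : Set M), a • sSup X = sSup ((fun x => a • x) '' X)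
  sSup_smul' : ∀ (A : Set Q) (x : M), sSup A • x = sSup ((fun a => a • x) '' A)

/-- Homomorphisms of quantale modules. -/
structure QuantaleModuleHom (Q M N : Type*) [Monoid Q] [CompleteLattice Q] [IsQuantale Q]
    [CompleteLattice M] [CompleteLattice N] [QuantaleModule Q M] [QuantaleModule Q N] where
  toFun : M → N
  map_sSup' : ∀ X : Set M, toFun (sSup X) = sSup (toFun '' X)
  map_smul' : ∀ (a : Q) (x : M), toFun (a • x) = a • toFun x

/-- Two modules over the same quantale are isomorphic: there are mutually inverse
homomorphisms. -/
def ModuleIsomorphic (Q M N : Type*) [Monoid Q] [CompleteLattice Q] [IsQuantale Q]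
    [CompleteLattice M] [CompleteLattice N] [QuantaleModule Q M] [QuantaleModule Q N] : Prop :=
  ∃ (f : QuantaleModuleHom Q M N) (g : QuantaleModuleHom Q N M),
    (∀ x, g.toFun (f.toFun x) = x) ∧ ∀ y, f.toFun (g.toFun y) = y

/-- A nucleus (structural closure operator) on a quantale module. -/
structure ModuleNucleus (Q M : Type*) [Monoid Q] [CompleteLattice Q] [IsQuantale Q]
    [CompleteLattice M] [QuantaleModule Q M] where
  clo : ClosureOperator M
  smul_le : ∀ (a : Q) (x : M), a • clo x ≤ clo (a • x)

section Restriction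

variable {Q R : Type*} [Monoid Q] [CompleteLattice Q] [IsQuantale Q]
  [Monoid R] [CompleteLattice R] [IsQuantale R]

/-- The module `N_h` obtained from an `R`-module `N` by restriction of scalars along
`h : Q → R`: the same sup-lattice, with `a • x = h a • x`. -/
def Restricted (_h : QuantaleHom Q R) (N : Type*) : Type _ := N

instance (h : QuantaleHom Q R) (N : Type*) [CompleteLattice N] :
    CompleteLattice (Restricted h N) :=
  inferInstanceAs (CompleteLattice N)

instance (h : QuantaleHom Q R) (N : Type*) [CompleteLattice N] [QuantaleModule R N] :
    QuantaleModule Q (Restricted h N) where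
  smul a x := (h a • (show N from x) : N)
  one_smul x := by
    change (h.toMonoidHom 1 • (show N from x) : N) = x
    rw [map_one, one_smul]
  mul_smul a b x := by
    change (h.toMonoidHom (a * b) • (show N from x) : N)
      = h.toMonoidHom a • h.toMonoidHom b • (show N from x)
    rw [map_mul, mul_smul]
  smul_sSup' a X := QuantaleModule.smul_sSup' (M := N) (h a) X
  sSup_smul' A x := by
    change (h.toMonoidHom.toFun (sSup A) • (show N from x) : N) = _
    rw [h.map_sSup', QuantaleModule.sSup_smul', Set.image_image]
    rfl

end Restriction

section Nucleus

variable {Q M : Type*} [Monoid Q] [CompleteLattice Q] [IsQuantale Q]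
  [CompleteLattice M] [QuantaleModule Q M]

theorem smul_mono_right (a : Q) {x y : M} (hxy : x ≤ y) : a • x ≤ a • y := by
  have h := QuantaleModule.smul_sSup' a ({x, y} : Set M)
  rw [sSup_pair, sup_eq_right.2 hxy] at h
  rw [h]
  exact le_sSup ⟨x, by simp, rfl⟩

namespace ModuleNucleus

variable (g : ModuleNucleus Q M)

/-- The set `M_γ` of closed elements, which is the same as the image of `γ`. -/
def Fixed : Type _ := g.clo.Closeds

/-- The complete lattice of closed elements; its joins are `γ (⋁ X)`. -/
instance : CompleteLattice g.Fixed :=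
  g.clo.gi.liftCompleteLattice

/-- The underlying element of a closed element. -/
def Fixed.val {g : ModuleNucleus Q M} (x : g.Fixed) : M := Subtype.val x

/-- The canonical projection onto the closed elements. -/
def proj (x : M) : g.Fixed := g.clo.toCloseds x

theorem Fixed.ext {g : ModuleNucleus Q M} {x y : g.Fixed} (h : x.val = y.val) : x = y :=
  Subtype.ext h

theorem proj_val (x : g.Fixed) : g.proj x.val = x :=
  Subtype.ext (x.2.closure_eq)

theorem val_proj (x : M) : (g.proj x).val = g.clo x := rfl

theorem sSup_fixed (X : Set g.Fixed) : sSup X = g.proj (sSup (Fixed.val '' X)) := rfl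

theorem clo_smul_clo (a : Q) (x : M) : g.clo (a • g.clo x) = g.clo (a • x) := by
  apply le_antisymm
  · have := g.clo.monotone (g.smul_le a x)
    rwa [g.clo.idempotent] at this
  · exact g.clo.monotone (smul_mono_right a (g.clo.le_closure x))

theorem clo_sSup_clo (X : Set M) : g.clo (sSup (g.clo '' X)) = g.clo (sSup X) := by
  apply le_antisymm
  · have h : sSup (g.clo '' X) ≤ g.clo (sSup X) := by
      apply sSup_le
      rintro _ ⟨x, hx, rfl⟩
      exact g.clo.monotone (le_sSup hx)
    have := g.clo.monotone h
    rwa [g.clo.idempotent] at this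
  · apply g.clo.monotone
    apply sSup_le
    intro x hx
    exact (g.clo.le_closure x).trans (le_sSup ⟨x, hx, rfl⟩)

/-- The module `M_γ` with scalar multiplication `a •_γ x = γ (a • x)`. -/
instance : QuantaleModule Q g.Fixed where
  smul a x := g.proj (a • x.val)
  one_smul x := by
    change g.proj ((1 : Q) • x.val) = x
    rw [one_smul, proj_val]
  mul_smul a b x := by
    apply Fixed.ext
    change g.clo ((a * b) • x.val) = g.clo (a • g.clo (b • x.val))
    rw [clo_smul_clo, mul_smul]
  smul_sSup' a X := by
    apply Fixed.ext
    change g.clo (a • g.clo (sSup (Fixed.val '' X)))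
      = g.clo (sSup (Fixed.val '' ((fun x : g.Fixed => g.proj (a • x.val)) '' X)))
    rw [clo_smul_clo, QuantaleModule.smul_sSup', ← clo_sSup_clo, Set.image_image, Set.image_image,
      Set.image_image]
    rfl
  sSup_smul' A x := by
    apply Fixed.ext
    change g.clo (sSup A • x.val)
      = g.clo (sSup (Fixed.val '' ((fun a : Q => g.proj (a • x.val)) '' A)))
    rw [QuantaleModule.sSup_smul', ← clo_sSup_clo, Set.image_image, Set.image_image]
    rfl

end ModuleNucleus

end Nucleus

/-! ### The quantale of subsets of a monoid and the module of subsets of a set it acts on -/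

section Powerset

variable {A B S : Type*} [Monoid A] [Monoid B] [MulAction A S]

/-- The subsets of a monoid form a quantale, with union and the complex product. -/
instance : IsQuantale (Set A) where
  mul_sSup_distrib x s := by
    ext a
    simp only [Set.sSup_eq_sUnion, Set.iSup_eq_iUnion, Set.mem_mul, Set.mem_sUnion, Set.mem_iUnion]
    grind
  sSup_mul_distrib s y := by
    ext a
    simp only [Set.sSup_eq_sUnion, Set.iSup_eq_iUnion, Set.mem_mul, Set.mem_sUnion, Set.mem_iUnion]
    grind

/-- The subsets of a set acted on by `A` form a module over the quantale of subsets of `A`,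
with `B • X = {b • x | b ∈ B, x ∈ X}`. -/
noncomputable instance : QuantaleModule (Set A) (Set S) where
  toMulAction := Set.mulAction
  smul_sSup' a X := by
    ext s
    simp only [Set.sSup_eq_sUnion, Set.mem_smul, Set.mem_sUnion, Set.mem_image]
    grind [Set.mem_smul]
  sSup_smul' Y x := by
    ext s
    simp only [Set.sSup_eq_sUnion, Set.mem_smul, Set.mem_sUnion, Set.mem_image]
    grind [Set.mem_smul]

/-- The quantale homomorphism `X ↦ f[X]` that extends a monoid homomorphism `f`. -/
def powersetHom (f : A →* B) : QuantaleHom (Set A) (Set B) where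
  toFun X := f '' X
  map_one' := by rw [← Set.singleton_one, Set.image_singleton, map_one, Set.singleton_one]
  map_mul' X Y := Set.image_mul f
  map_sSup' X := by
    simp only [Set.sSup_eq_sUnion, Set.image_sUnion]

/-- The nucleus `X ↦ {u | X ⊢ u}` of an action-invariant consequence relation. -/
def ConsequenceRelation.nucleus (c : ConsequenceRelation S) (hc : c.ActionInvariant A) :
    ModuleNucleus (Set A) (Set S) where
  clo := ClosureOperator.mk' (fun X => {u | c.rel X u})
    (fun X Y hXY u hu => c.mono X Y u hu hXY)
    (fun X u hu => c.refl X u hu)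
    (fun X u hu => c.cut X _ u hu (fun _ hv => hv))
  smul_le := by
    intro Y X
    rintro _ ⟨a, ha, u, hu, rfl⟩
    refine c.mono _ _ _ (hc a X u hu) ?_
    rintro _ ⟨x, hx, rfl⟩
    exact ⟨a, ha, x, hx, rfl⟩

end Powerset

/-! ### Propositional languages, formulas, substitutions -/

/-- A propositional language: connectives with their arities (constants have arity 0). -/
structure PropLang where
  Conn : Type u
  arity : Conn → ℕ

/-- Formulas over the propositional variables `x₀, x₁, …`. -/
inductive Fm (L : PropLang.{u}) : Type u
  | var : ℕ → Fm L
  | app (f : L.Conn) (args : Fin (L.arity f) → Fm L) : Fm L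

/-- The monoid of substitutions: endomorphisms of the term algebra under composition. -/
def substitutions (L : PropLang.{u}) : Submonoid (Function.End (Fm L)) where
  carrier := {s | ∀ (f : L.Conn) (args : Fin (L.arity f) → Fm L),
    s (Fm.app f args) = Fm.app f (fun i => s (args i))}
  one_mem' _ _ := rfl
  mul_mem' {a b} ha hb f args := by
    change a (b _) = _
    rw [hb, ha]
    rfl

/-- The substitution monoid `Σ_L`; it acts on formulas by `σ • φ = σ(φ)`. -/
abbrev Subst (L : PropLang.{u}) : Type u := substitutions L

/-- The homomorphic extension of an assignment of formulas to variables. -/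
def Fm.extend {L : PropLang.{u}} (s : ℕ → Fm L) : Fm L → Fm L
  | .var n => s n
  | .app f args => .app f (fun i => (args i).extend s)

/-- The substitution that renames variables according to `r`. These are exactly the
substitutions that map variables to variables (`mem_range_renameSubst`), and `r` identifies
the variable substitutions of different languages with each other. -/
def renameSubst (L : PropLang.{u}) (r : ℕ → ℕ) : Subst L :=
  ⟨Fm.extend (fun n => Fm.var (r n)), fun _ _ => rfl⟩

theorem mem_range_renameSubst {L : PropLang.{u}} (s : Subst L) :
    s ∈ Set.range (renameSubst L) ↔ ∀ n : ℕ, ∃ m : ℕ, s • (Fm.var n : Fm L) = Fm.var m := by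
  constructor
  · rintro ⟨r, rfl⟩ n
    exact ⟨r n, rfl⟩
  · intro h
    choose r hr using h
    refine ⟨r, Subtype.ext (funext fun p => ?_)⟩
    induction p with
    | var n => exact (hr n).symm
    | app f args ih =>
      rw [s.2 f args]
      change Fm.app f _ = _
      congr 1
      funext i
      exact ih i

/-! ### Sequents and deductive systems -/

/-- A sequent `Γ ⇒ Δ`: two finite sequences of formulas, not both empty. -/
@[ext]
structure Sequent (L : PropLang.{u}) where
  left : List (Fm L)
  right : List (Fm L)
  nonempty : left ≠ [] ∨ right ≠ []

/-- The type `(m, n)` of a sequent. -/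
def Sequent.type {L : PropLang.{u}} (s : Sequent L) : ℕ × ℕ :=
  (s.left.length, s.right.length)

/-- Substitutions act on sequents formula by formula. -/
instance (L : PropLang.{u}) : MulAction (Subst L) (Sequent L) where
  smul a s := ⟨s.left.map (fun p => a • p), s.right.map (fun p => a • p), by
    simpa using s.nonempty⟩
  one_smul s := by
    ext1
    · change s.left.map (fun p => (1 : Subst L) • p) = s.left
      simp
    · change s.right.map (fun p => (1 : Subst L) • p) = s.right
      simp
  mul_smul a b s := by
    ext1
    · change s.left.map (fun p => (a * b) • p)
        = (s.left.map (fun p => b • p)).map (fun p => a • p)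
      simp [mul_smul]
    · change s.right.map (fun p => (a * b) • p)
        = (s.right.map (fun p => b • p)).map (fun p => a • p)
      simp [mul_smul]

theorem Sequent.type_smul {L : PropLang.{u}} (a : Subst L) (s : Sequent L) :
    (a • s).type = s.type := by
  change ((s.left.map _).length, (s.right.map _).length) = _
  simp [Sequent.type]

/-- A set of sequents closed under type: with a sequent of type `(m, n)` it contains all
sequents of type `(m, n)`. -/
structure SequentSet (L : PropLang.{u}) where
  carrier : Set (Sequent L)
  closed : ∀ s ∈ carrier, ∀ t : Sequent L, t.type = s.type → t ∈ carrier

/-- A set of sequents is stable under substitutions. -/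
def SequentSet.toSubMulAction {L : PropLang.{u}} (S : SequentSet L) :
    SubMulAction (Subst L) (Sequent L) where
  carrier := S.carrier
  smul_mem' a s hs := S.closed s hs _ (Sequent.type_smul a s)

/-- The elements of a set of sequents, with the action of substitutions. -/
abbrev SequentSet.Elem {L : PropLang.{u}} (S : SequentSet L) : Type u := S.toSubMulAction

/-- A propositional deductive system over `L`: a set of sequents closed under type with a
substitution-invariant consequence relation. -/
structure DeductiveSystem (L : PropLang.{u}) where
  sequents : SequentSet L
  cons : ConsequenceRelation sequents.Elem
  invariant : cons.ActionInvariant (Subst L)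

/-- The nucleus of a deductive system on the module of sets of sequents. -/
def DeductiveSystem.nucleus {L : PropLang.{u}} (S : DeductiveSystem L) :
    ModuleNucleus (Set (Subst L)) (Set S.sequents.Elem) :=
  S.cons.nucleus S.invariant

/-- The `℘(Σ_L)`-module `℘(S)_γ` of theories of a deductive system. -/
abbrev DeductiveSystem.theories {L : PropLang.{u}} (S : DeductiveSystem L) : Type u :=
  S.nucleus.Fixed

/-! ### Quantale translations -/

/-- Completely join-prime elements; in a powerset these are exactly the singletons. -/
def CompletelyJoinPrime {P : Type*} [CompleteLattice P] (p : P) : Prop :=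
  ∀ X : Set P, p ≤ sSup X → ∃ x ∈ X, p ≤ x

/-- Translations between quantales of sets of substitutions: quantale homomorphisms that
preserve completely join-prime elements, reflect multiplicative idempotency of completely
join-prime elements, and for which every set of variable substitutions has
exactly one preimage, namely itself. -/
structure IsTranslation {L : PropLang.{u}} {L' : PropLang.{v}}
    (h : QuantaleHom (Set (Subst L)) (Set (Subst L'))) : Prop where
  prime : ∀ X : Set (Subst L), CompletelyJoinPrime X → CompletelyJoinPrime (h X)
  idem : ∀ Y : Set (Subst L'), CompletelyJoinPrime Y → Y * Y = Y →
    ∀ X : Set (Subst L), CompletelyJoinPrime X → h X = Y → X * X = X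
  variable_substs : ∀ r : Set (ℕ → ℕ),
    (fun X => h X) ⁻¹' {renameSubst L' '' r} = {renameSubst L '' r}

/-- Equivalence of deductive systems via a homomorphism `h` of quantales of sets of
substitutions: `h` extends a monoid homomorphism `h₀` of the substitution monoids, and the
systems are equivalent via `h₀` and some monoid homomorphism `k₀` in the other direction. -/
def EquivalentVia {L : PropLang.{u}} {L' : PropLang.{v}}
    (S : DeductiveSystem L) (T : DeductiveSystem L')
    (h : QuantaleHom (Set (Subst L)) (Set (Subst L'))) : Prop :=
  ∃ (h₀ : Subst L →* Subst L') (k₀ : Subst L' →* Subst L),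
    h = powersetHom h₀ ∧ EquivalentViaPair S.cons T.cons h₀ k₀

/-- As `EquivalentVia`, where moreover the homomorphism in the other direction is
required to be a translation. -/
def TranslationEquivalentVia {L : PropLang.{u}} {L' : PropLang.{v}}
    (S : DeductiveSystem L) (T : DeductiveSystem L')
    (h : QuantaleHom (Set (Subst L)) (Set (Subst L'))) : Prop :=
  ∃ (h₀ : Subst L →* Subst L') (k₀ : Subst L' →* Subst L),
    h = powersetHom h₀ ∧ IsTranslation (powersetHom k₀) ∧
      EquivalentViaPair S.cons T.cons h₀ k₀

end PropLogic

open PropLogic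

namespace PropLogic

/-! ### Closed elements and consequence relations -/

section Closed

variable {Q M : Type*} [Monoid Q] [CompleteLattice Q] [IsQuantale Q]
  [CompleteLattice M] [QuantaleModule Q M]

namespace ModuleNucleus

variable (g : ModuleNucleus Q M)

/-! From equivalence to isomorphism: a weak representation ι preserves and reflects entailment
between sets, so X ↦ δ(ι[X]) is well defined and injective on theories. It respects joins and
scalars, and v ⊣⊢ ι[ι'(v)] makes it onto (`EquivalentViaPair.moduleIsomorphic`).

From isomorphism to equivalence, two ingredients are needed.

A section of h. Since h preserves singletons, it is the direct image under a monoid homomorphism h₀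
(`exists_eq_powersetHom`), which fixes variable renamings and is onto. Then h₀ comes from a
surjective map of formulas (`formulaMap`), so each g(x₀, …, xₘ₋₁) has a preimage `c g`. Reflection
of idempotents forces the variables of `c g` to lie among x₀, …, xₘ₋₁ (`lt_arity_of_mem_vars`), so
replacing g by `c g` commutes with substitution and gives a section k₀ of h₀ (`exists_section`).
Being injective and fixing renamings, k₀ induces a translation.

Lifting. Every sequent is a substitution instance of the sequent of distinct variables of its type,
and the substitution can be chosen equivariantly. Hence module homomorphisms between theories lift
to strictly equivariant maps from sequents to sets of sequents (`exists_actionInvariantVia`). The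
isomorphism and its inverse lift along h₀ and k₀ to ι and ι'
(`equivalentViaPair_of_moduleIsomorphic`). -/

theorem proj_le_proj_iff {x y : M} : g.proj x ≤ g.proj y ↔ x ≤ g.clo y :=
  g.clo.le_closure_iff.symm

theorem proj_smul (a : Q) (x : M) : g.proj (a • x) = a • g.proj x :=
  Fixed.ext (g.clo_smul_clo a x).symm

theorem proj_sSup (X : Set M) : g.proj (sSup X) = sSup (g.proj '' X) := by
  rw [sSup_fixed, Set.image_image]
  exact Fixed.ext (g.clo_sSup_clo X).symm

end ModuleNucleus

/-- The inverse of a bijective module homomorphism is a module homomorphism. -/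
theorem ModuleIsomorphic.of_bijective {N : Type*} [CompleteLattice N] [QuantaleModule Q N]
    (f : QuantaleModuleHom Q M N) (hf : Function.Bijective f.toFun) : ModuleIsomorphic Q M N := by
  obtain ⟨e, he, he'⟩ := Function.bijective_iff_has_inverse.1 hf
  refine ⟨f, ⟨e, fun X => hf.1 ?_, fun a x => hf.1 ?_⟩, he, he'⟩
  · rw [he', f.map_sSup', Set.image_image]
    simp [he' _]
  · rw [he', f.map_smul', he']

end Closed

section Consequence

variable {A B S T : Type*} [Monoid A] [Monoid B] [MulAction A S] [MulAction B T]
  {c : ConsequenceRelation S} {d : ConsequenceRelation T}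

theorem proj_nucleus_le_iff (hc : c.ActionInvariant A) {X Y : Set S} :
    (c.nucleus hc).proj X ≤ (c.nucleus hc).proj Y ↔ c.entails Y X :=
  (c.nucleus hc).proj_le_proj_iff

theorem proj_nucleus_eq_iff (hc : c.ActionInvariant A) {X Y : Set S} :
    (c.nucleus hc).proj X = (c.nucleus hc).proj Y ↔ c.entails Y X ∧ c.entails X Y := by
  rw [le_antisymm_iff, proj_nucleus_le_iff, proj_nucleus_le_iff]

theorem setExtend_eq_sSup (i : S → Set T) (X : Set S) : setExtend i X = sSup (i '' X) := by
  simp [setExtend]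

theorem setExtend_sSup (i : S → Set T) (X : Set (Set S)) :
    setExtend i (sSup X) = sSup (setExtend i '' X) := by
  ext t
  simp only [setExtend, Set.sSup_eq_sUnion, Set.mem_iUnion, Set.mem_sUnion, Set.mem_image,
    exists_exists_and_eq_and]
  grind

theorem setExtend_smul {h : A →* B} {i : S → Set T} (hi : ActionInvariantVia h i)
    (a : Set A) (X : Set S) : setExtend i (a • X) = (h '' a) • setExtend i X := by
  ext t
  simp only [setExtend, Set.mem_iUnion, Set.mem_smul, Set.mem_image]
  constructor
  · rintro ⟨_, ⟨a, ha, x, hx, rfl⟩, ht⟩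
    rw [hi] at ht
    obtain ⟨y, hy, rfl⟩ := ht
    exact ⟨_, ⟨a, ha, rfl⟩, y, ⟨x, hx, hy⟩, rfl⟩
  · rintro ⟨_, ⟨a, ha, rfl⟩, y, ⟨x, hx, hy⟩, rfl⟩
    exact ⟨_, ⟨a, ha, x, hx, rfl⟩, by rw [hi]; exact ⟨y, hy, rfl⟩⟩

theorem IsWeakRepresentation.entails_iff {i : S → Set T} (hi : IsWeakRepresentation c d i)
    {X Y : Set S} : c.entails X Y ↔ d.entails (setExtend i X) (setExtend i Y) := by
  constructor
  · intro H v hv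
    obtain ⟨y, hy, hv⟩ := Set.mem_iUnion₂.1 hv
    exact (hi X y).1 (H y hy) v hv
  · intro H y hy
    exact (hi X y).2 fun v hv => H v (Set.mem_iUnion₂.2 ⟨y, hy, hv⟩)

/-- From right to left this makes the induced map on theories well defined, from left to right
injective. -/
theorem IsWeakRepresentation.proj_eq_iff {i : S → Set T} (hi : IsWeakRepresentation c d i)
    (hc : c.ActionInvariant A) (hd : d.ActionInvariant B) {X Y : Set S} :
    (d.nucleus hd).proj (setExtend i X) = (d.nucleus hd).proj (setExtend i Y) ↔
      (c.nucleus hc).proj X = (c.nucleus hc).proj Y := by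
  rw [proj_nucleus_eq_iff, proj_nucleus_eq_iff, hi.entails_iff, hi.entails_iff]

/-- Equivalent consequence relations have isomorphic modules of theories. -/
theorem EquivalentViaPair.moduleIsomorphic {h : A →* B} {k : B →* A}
    (H : EquivalentViaPair c d h k) (hc : c.ActionInvariant A) (hd : d.ActionInvariant B) :
    ModuleIsomorphic (Set A) (c.nucleus hc).Fixed
      (Restricted (powersetHom h) (d.nucleus hd).Fixed) := by
  obtain ⟨i, j, ⟨hi, -, hij⟩, hhi, -⟩ := H
  -- Closing X first does not change the theory of its image, so joins and scalar multiples can be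
  -- computed on generating sets.
  have key : ∀ X, (d.nucleus hd).proj (setExtend i ((c.nucleus hc).proj X).val) =
      (d.nucleus hd).proj (setExtend i X) := fun X =>
    (hi.proj_eq_iff hc hd).2 (ModuleNucleus.proj_val _ _)
  refine .of_bijective
    ⟨fun X => (d.nucleus hd).proj (setExtend i X.val), fun X => ?_, fun a X => ?_⟩ ⟨?_, ?_⟩
  · rw [ModuleNucleus.sSup_fixed, key, setExtend_sSup, ModuleNucleus.proj_sSup, Set.image_image,
      Set.image_image]
    rfl
  · change (d.nucleus hd).proj (setExtend i ((c.nucleus hc).proj (a • X.val)).val) = _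
    rw [key, setExtend_smul hhi, ModuleNucleus.proj_smul]
    rfl
  · intro X Y hXY
    have := (hi.proj_eq_iff hc hd).1 hXY
    rwa [ModuleNucleus.proj_val, ModuleNucleus.proj_val] at this
  · intro (Y : (d.nucleus hd).Fixed)
    -- The preimage of Y is the theory generated by ι'[Y]; the derivabilities v ⊣⊢ ι[ι'(v)] for v in
    -- Y add up to Y ⊣⊢ ι[ι'[Y]].
    refine ⟨(c.nucleus hc).proj (setExtend j Y.val), ?_⟩
    refine (key _).trans (Eq.trans ?_ ((d.nucleus hd).proj_val Y))
    rw [proj_nucleus_eq_iff]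
    constructor
    · intro t ht
      obtain ⟨x, hx, ht⟩ := Set.mem_iUnion₂.1 ht
      obtain ⟨y, hy, hx⟩ := Set.mem_iUnion₂.1 hx
      exact d.mono _ _ _ ((hij y).1 t (Set.mem_iUnion₂.2 ⟨x, hx, ht⟩))
        (Set.singleton_subset_iff.2 hy)
    · intro y hy
      refine d.mono _ _ _ ((hij y).2 y rfl) ?_
      exact Set.biUnion_subset_biUnion_left fun x hx => Set.mem_iUnion₂.2 ⟨y, hy, hx⟩

/-- If every element `x` is `s x • e x` with `s` equivariant and `e` invariant, then a
homomorphism of modules of theories is induced by an equivariant map into sets. -/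
theorem exists_actionInvariantVia (hc : c.ActionInvariant A) (hd : d.ActionInvariant B)
    (h : A →* B) (s : S → A) (e : S → S) (hs : ∀ (a : A) x, s (a • x) = a * s x)
    (he : ∀ (a : A) x, e (a • x) = e x) (hse : ∀ x, s x • e x = x)
    (F : (c.nucleus hc).Fixed → (d.nucleus hd).Fixed)
    (hF : ∀ (a : A) X, F (({a} : Set A) • X) = ({h a} : Set B) • F X) :
    ∃ i : S → Set T, ActionInvariantVia h i ∧
      ∀ x, (d.nucleus hd).proj (i x) = F ((c.nucleus hc).proj {x}) := by
  -- The theory F(γ{x}) itself would be equivariant only up to closure. Evaluating F at `e x`, which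
  -- is constant on orbits, and applying `h (s x)` without closing makes the equality strict.
  refine ⟨fun x => ({h (s x)} : Set B) • (F ((c.nucleus hc).proj {e x})).val,
    fun a x => ?_, fun x => ?_⟩
  · beta_reduce
    rw [hs, he, map_mul, ← Set.singleton_mul_singleton, mul_smul]
    exact Set.singleton_smul
  · rw [ModuleNucleus.proj_smul, ModuleNucleus.proj_val, ← hF, ← ModuleNucleus.proj_smul,
      Set.singleton_smul_singleton, hse]

theorem proj_setExtend (hc : c.ActionInvariant A) (hd : d.ActionInvariant B)
    {F : (c.nucleus hc).Fixed → (d.nucleus hd).Fixed}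
    (hF : ∀ X : Set (c.nucleus hc).Fixed, F (sSup X) = sSup (F '' X)) {i : S → Set T}
    (hi : ∀ x, (d.nucleus hd).proj (i x) = F ((c.nucleus hc).proj {x})) (X : Set S) :
    (d.nucleus hd).proj (setExtend i X) = F ((c.nucleus hc).proj X) := by
  have hX : X = sSup ((fun x => ({x} : Set S)) '' X) := by
    simp
  conv_rhs => rw [hX, ModuleNucleus.proj_sSup, hF, Set.image_image, Set.image_image]
  rw [setExtend_eq_sSup, ModuleNucleus.proj_sSup, Set.image_image]
  simp only [hi]

/-- X ⊢ u amounts to γ{u} ∨ γ(X) = γ(X), an equation that an injective join-preserving map both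
preserves and reflects. -/
theorem isWeakRepresentation_of_proj (hc : c.ActionInvariant A) (hd : d.ActionInvariant B)
    {F : (c.nucleus hc).Fixed → (d.nucleus hd).Fixed}
    (hF : ∀ X : Set (c.nucleus hc).Fixed, F (sSup X) = sSup (F '' X))
    (hFinj : Function.Injective F) {i : S → Set T}
    (hi : ∀ x, (d.nucleus hd).proj (i x) = F ((c.nucleus hc).proj {x})) :
    IsWeakRepresentation c d i := by
  have hsup : ∀ X Y, F (X ⊔ Y) = F X ⊔ F Y := fun X Y => by
    rw [← sSup_pair, hF, Set.image_pair, sSup_pair]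
  intro X u
  have h1 : c.rel X u ↔ c.entails X {u} := by simp [ConsequenceRelation.entails]
  rw [h1, ← proj_nucleus_le_iff hc, ← proj_nucleus_le_iff hd, proj_setExtend hc hd hF hi, hi,
    ← sup_eq_right, ← sup_eq_right, ← hsup, hFinj.eq_iff]

/-- Consequence relations with isomorphic modules of theories are equivalent, provided that the
elements decompose equivariantly and that the homomorphism of monoids has a section. -/
theorem equivalentViaPair_of_moduleIsomorphic (hc : c.ActionInvariant A)
    (hd : d.ActionInvariant B) {h : A →* B} {k : B →* A} (hk : ∀ b, h (k b) = b)
    (s : S → A) (e : S → S) (hs : ∀ (a : A) x, s (a • x) = a * s x)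
    (he : ∀ (a : A) x, e (a • x) = e x) (hse : ∀ x, s x • e x = x)
    (s' : T → B) (e' : T → T) (hs' : ∀ (b : B) x, s' (b • x) = b * s' x)
    (he' : ∀ (b : B) x, e' (b • x) = e' x) (hse' : ∀ x, s' x • e' x = x)
    (H : ModuleIsomorphic (Set A) (c.nucleus hc).Fixed
      (Restricted (powersetHom h) (d.nucleus hd).Fixed)) :
    EquivalentViaPair c d h k := by
  obtain ⟨⟨F, hF, hF'⟩, ⟨G, hG, hG'⟩, hGF, hFG⟩ := H
  change (c.nucleus hc).Fixed → (d.nucleus hd).Fixed at F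
  change (d.nucleus hd).Fixed → (c.nucleus hc).Fixed at G
  have hF₁ : ∀ (a : A) X, F (({a} : Set A) • X) = ({h a} : Set B) • F X := fun a X => by
    rw [← Set.image_singleton]
    exact hF' {a} X
  -- In the restricted module `k b` acts as h (k b) = b, so linearity of G over the subsets of A
  -- becomes equivariance along k. This is where the section property enters.
  have hG₁ : ∀ (b : B) Y, G (({b} : Set B) • Y) = ({k b} : Set A) • G Y := fun b Y => by
    have h1 : ({b} : Set B) = h '' {k b} := by rw [Set.image_singleton, hk]
    rw [h1]
    exact hG' {k b} Y
  obtain ⟨i, hi, hi'⟩ := exists_actionInvariantVia hc hd h s e hs he hse F hF₁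
  obtain ⟨j, hj, hj'⟩ := exists_actionInvariantVia hd hc k s' e' hs' he' hse' G hG₁
  refine ⟨i, j, ⟨isWeakRepresentation_of_proj hc hd hF (Function.LeftInverse.injective hGF) hi',
    isWeakRepresentation_of_proj hd hc hG (Function.LeftInverse.injective hFG) hj',
    fun v => ?_⟩, hi, hj⟩
  -- Mutual derivability becomes F(G(δ{v})) = δ{v}.
  rw [← proj_nucleus_eq_iff hd, proj_setExtend hc hd hF hi', hj']
  exact hFG _

end Consequence

/-! ### Quantale homomorphisms between powersets -/

theorem completelyJoinPrime_set_iff {α : Type*} {X : Set α} :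
    CompletelyJoinPrime X ↔ ∃ a, X = {a} := by
  constructor
  · intro H
    obtain ⟨_, ⟨a, ha, rfl⟩, h⟩ := H ((fun x => ({x} : Set α)) '' X) (by simp)
    exact ⟨a, h.antisymm (Set.singleton_subset_iff.2 ha)⟩
  · rintro ⟨a, rfl⟩ Y hY
    obtain ⟨y, hy, ha⟩ := hY rfl
    exact ⟨y, hy, Set.singleton_subset_iff.2 ha⟩

theorem QuantaleHom.ext {Q R : Type*} [Monoid Q] [CompleteLattice Q] [IsQuantale Q]
    [Monoid R] [CompleteLattice R] [IsQuantale R] {f g : QuantaleHom Q R}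
    (H : ∀ x, f x = g x) : f = g := by
  cases f
  cases g
  congr
  exact MonoidHom.ext H

/-- A homomorphism of powerset quantales that preserves singletons is the direct image under
a monoid homomorphism. -/
theorem exists_eq_powersetHom {A B : Type*} [Monoid A] [Monoid B]
    (h : QuantaleHom (Set A) (Set B))
    (hp : ∀ X : Set A, CompletelyJoinPrime X → CompletelyJoinPrime (h X)) :
    ∃ h₀ : A →* B, h = powersetHom h₀ := by
  choose f hf using fun a : A =>
    completelyJoinPrime_set_iff.1 (hp {a} (completelyJoinPrime_set_iff.2 ⟨a, rfl⟩))
  refine ⟨⟨⟨f, ?_⟩, fun a b => ?_⟩, QuantaleHom.ext fun X => ?_⟩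
  · apply Set.singleton_injective
    rw [← hf, Set.singleton_one, map_one, Set.singleton_one]
  · apply Set.singleton_injective
    rw [← hf, ← Set.singleton_mul_singleton, map_mul, hf, hf, Set.singleton_mul_singleton]
  · have hX : X = sSup ((fun x => ({x} : Set A)) '' X) := by simp
    have := h.map_sSup' ((fun x => ({x} : Set A)) '' X)
    rw [← hX, Set.image_image] at this
    refine this.trans ?_
    change sSup ((fun x => h {x}) '' X) = f '' X
    ext b
    simp [hf, eq_comm]

theorem powersetHom_apply {A B : Type*} [Monoid A] [Monoid B] (f : A →* B) (X : Set A) :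
    powersetHom f X = f '' X := rfl

/-! ### Substitutions -/

section Substitutions

variable {L : PropLang.{u}} {L' : PropLang.{v}}

/-- The substitution that extends an assignment of formulas to variables. -/
def assign (s : ℕ → Fm L) : Subst L :=
  ⟨Fm.extend s, fun _ _ => rfl⟩

@[simp]
theorem assign_smul_var (s : ℕ → Fm L) (n : ℕ) : assign s • (Fm.var n : Fm L) = s n := rfl

theorem smul_app (a : Subst L) (f : L.Conn) (args : Fin (L.arity f) → Fm L) :
    a • Fm.app f args = Fm.app f fun i => a • args i :=
  a.2 f args

/-- The set of variables that occur in a formula. -/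
def Fm.vars : Fm L → Set ℕ
  | .var n => {n}
  | .app _ args => ⋃ i, (args i).vars

theorem smul_eq_smul_iff {a b : Subst L} {p : Fm L} :
    a • p = b • p ↔ ∀ n ∈ p.vars, a • (Fm.var n : Fm L) = b • (Fm.var n : Fm L) := by
  induction p with
  | var n => simp [Fm.vars]
  | app f args ih =>
    simp only [smul_app, Fm.app.injEq, heq_eq_eq, true_and, funext_iff, ih, Fm.vars,
      Set.mem_iUnion]
    grind

theorem Subst.ext {a b : Subst L}
    (H : ∀ n, a • (Fm.var n : Fm L) = b • (Fm.var n : Fm L)) : a = b :=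
  Subtype.ext (funext fun p => (smul_eq_smul_iff (p := p)).2 fun n _ => H n)

theorem mul_renameSubst (a : Subst L) (r : ℕ → ℕ) (n : ℕ) :
    (a * renameSubst L r) • (Fm.var n : Fm L) = a • (Fm.var (r n) : Fm L) := rfl

/-- The map of formulas induced by a homomorphism of substitution monoids. -/
def formulaMap (h : Subst L →* Subst L') (p : Fm L) : Fm L' :=
  h (assign fun _ => p) • Fm.var 0

/-- Composing a with the renaming of all variables to xₙ gives the constant substitution with value
a(xₙ), and h fixes that renaming. So h is determined by its map of formulas. -/
theorem hom_smul_var {h : Subst L →* Subst L'} (hr : ∀ r, h (renameSubst L r) = renameSubst L' r)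
    (a : Subst L) (n : ℕ) :
    h a • (Fm.var n : Fm L') = formulaMap h (a • (Fm.var n : Fm L)) := by
  have h1 : (assign fun _ => a • (Fm.var n : Fm L)) = a * renameSubst L fun _ => n :=
    Subst.ext fun m => (mul_renameSubst a (fun _ => n) m).symm
  rw [formulaMap, h1, map_mul, hr, mul_renameSubst]

theorem formulaMap_smul {h : Subst L →* Subst L'}
    (hr : ∀ r, h (renameSubst L r) = renameSubst L' r) (a : Subst L) (p : Fm L) :
    formulaMap h (a • p) = h a • formulaMap h p := by
  have h1 := hom_smul_var hr (a * assign fun _ => p) 0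
  rw [map_mul, mul_smul, mul_smul] at h1
  exact h1.symm

theorem formulaMap_var {h : Subst L →* Subst L'}
    (hr : ∀ r, h (renameSubst L r) = renameSubst L' r) (n : ℕ) :
    formulaMap h (Fm.var n) = Fm.var n := by
  have h1 := hom_smul_var hr 1 n
  rw [map_one, one_smul, one_smul] at h1
  exact h1.symm

theorem formulaMap_surjective {h : Subst L →* Subst L'}
    (hr : ∀ r, h (renameSubst L r) = renameSubst L' r) (hsurj : Function.Surjective h) :
    Function.Surjective (formulaMap h) := fun q => by
  obtain ⟨a, ha⟩ := hsurj (assign fun _ => q)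
  exact ⟨a • (Fm.var 0 : Fm L), by rw [← hom_smul_var hr, ha, assign_smul_var]⟩

/-- The assignment of the arguments of a connective to the first variables. -/
def argAssign {m : ℕ} (args : Fin m → Fm L) (n : ℕ) : Fm L :=
  if hn : n < m then args ⟨n, hn⟩ else Fm.var n

/-- The translation of formulas that replaces each connective `g` by the formula `c g`. -/
def Fm.translate (c : L'.Conn → Fm L) : Fm L' → Fm L
  | .var n => .var n
  | .app g args => (c g).extend (argAssign fun i => (args i).translate c)

/-- The formula `g(x₀, …, xₘ₋₁)`. -/
def basicFormula (g : L'.Conn) : Fm L' :=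
  Fm.app g fun i => Fm.var i

/-- A formula that is sent to the basic formula `g(x₀, …, xₘ₋₁)` contains no variables besides
`x₀, …, xₘ₋₁` if the homomorphism reflects idempotent substitutions. -/
theorem lt_arity_of_mem_vars {h : Subst L →* Subst L'}
    (hr : ∀ r, h (renameSubst L r) = renameSubst L' r)
    (hidem : ∀ a, IsIdempotentElem (h a) → IsIdempotentElem a) {g : L'.Conn} {p : Fm L}
    (hp : formulaMap h p = basicFormula g) {n : ℕ} (hn : n ∈ p.vars) : n < L'.arity g := by
  by_contra hlt
  -- This substitution moves at most xₙ. As n is not below the arity, xₙ does not occur in the basic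
  -- formula, so h a is idempotent.
  set a : Subst L := assign (Function.update Fm.var n p) with ha
  have hvar : ∀ m, m ≠ n → h a • (Fm.var m : Fm L') = Fm.var m := fun m hm => by
    rw [hom_smul_var hr, ha, assign_smul_var, Function.update_of_ne hm, formulaMap_var hr]
  have hvar' : h a • (Fm.var n : Fm L') = basicFormula g := by
    rw [hom_smul_var hr, ha, assign_smul_var, Function.update_self, hp]
  have hai : IsIdempotentElem (h a) := Subst.ext fun m => by
    rw [mul_smul]
    by_cases hm : m = n
    · subst hm
      rw [hvar', basicFormula, smul_app]
      congr 1
      funext i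
      exact hvar i fun hi => hlt (hi ▸ i.2)
    · rw [hvar m hm, hvar m hm]
  -- By reflection a is idempotent, so a(p) = a(a(xₙ)) = a(xₙ) = p.
  have hap : a • p = (1 : Subst L) • p := by
    have h1 : a • (Fm.var n : Fm L) = p := by rw [ha, assign_smul_var, Function.update_self]
    have h2 := congrArg (fun b : Subst L => b • (Fm.var n : Fm L)) (hidem a hai).eq
    simp only [mul_smul, h1] at h2
    rw [h2, one_smul]
  -- Since a fixes p, it fixes the variable xₙ occurring in p; thus p = xₙ, whose image is a
  -- variable and not a compound formula.
  have hpn : p = Fm.var n := by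
    have := smul_eq_smul_iff.1 hap n hn
    rwa [ha, assign_smul_var, Function.update_self, one_smul] at this
  rw [hpn, formulaMap_var hr] at hp
  cases hp

/-- The bound on variables is essential: a further variable xₙ of `c g` would be left alone on the
left-hand side, but replaced by the translation of b(xₙ) on the right. Below the arity the default
of `argAssign` plays no role. -/
theorem translate_smul {c : L'.Conn → Fm L} (hc : ∀ g, ∀ n ∈ (c g).vars, n < L'.arity g)
    (b : Subst L') (q : Fm L') :
    (b • q).translate c = assign (fun n => (b • (Fm.var n : Fm L')).translate c) • q.translate c := by
  induction q with
  | var n => rfl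
  | app g args ih =>
    rw [smul_app, Fm.translate, Fm.translate]
    change (assign _ : Subst L) • c g = (assign _ : Subst L) • (assign _ : Subst L) • c g
    rw [← mul_smul, smul_eq_smul_iff]
    intro n hn
    rw [mul_smul, assign_smul_var, assign_smul_var, argAssign, argAssign, dif_pos (hc g n hn),
      dif_pos (hc g n hn), ih]

theorem formulaMap_translate {h : Subst L →* Subst L'}
    (hr : ∀ r, h (renameSubst L r) = renameSubst L' r) {c : L'.Conn → Fm L}
    (hc : ∀ g, formulaMap h (c g) = basicFormula g) (q : Fm L') :
    formulaMap h (q.translate c) = q := by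
  induction q with
  | var n => exact formulaMap_var hr n
  | app g args ih =>
    change formulaMap h ((assign _ : Subst L) • c g) = _
    rw [formulaMap_smul hr, hc, basicFormula, smul_app]
    congr 1
    funext i
    rw [hom_smul_var hr, assign_smul_var, argAssign, dif_pos i.2, ih]

/-- A surjective homomorphism of substitution monoids that fixes the variable substitutions and
reflects idempotents has a section. -/
theorem exists_section {h : Subst L →* Subst L'}
    (hr : ∀ r, h (renameSubst L r) = renameSubst L' r)
    (hidem : ∀ a, IsIdempotentElem (h a) → IsIdempotentElem a) (hsurj : Function.Surjective h) :
    ∃ k : Subst L' →* Subst L, ∀ b, h (k b) = b := by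
  choose c hc using fun g : L'.Conn => formulaMap_surjective hr hsurj (basicFormula g)
  have hvars : ∀ g, ∀ n ∈ (c g).vars, n < L'.arity g := fun g n hn =>
    lt_arity_of_mem_vars hr hidem (hc g) hn
  refine ⟨⟨⟨fun b => assign fun n => (b • (Fm.var n : Fm L')).translate c, ?_⟩, fun b b' => ?_⟩,
    fun b => Subst.ext fun n => ?_⟩
  · exact Subst.ext fun n => by rw [assign_smul_var, one_smul, one_smul]; rfl
  · exact Subst.ext fun n => by
      simp only [assign_smul_var, mul_smul]
      exact translate_smul hvars b _
  · rw [hom_smul_var hr]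
    exact formulaMap_translate hr hc _

end Substitutions

/-! ### Sequents -/

section Sequents

variable {L : PropLang.{u}}

/-- The formulas of a sequent, listed from left to right. -/
def Sequent.formulas (s : Sequent L) : List (Fm L) :=
  s.left ++ s.right

theorem Sequent.formulas_ne_nil (s : Sequent L) : s.formulas ≠ [] := by
  have := s.nonempty
  simp only [Sequent.formulas, ne_eq, List.append_eq_nil_iff]
  tauto

theorem Sequent.formulas_smul (a : Subst L) (s : Sequent L) :
    (a • s).formulas = s.formulas.map fun p => a • p :=
  List.map_append.symm

/-- The substitution that sends the first variables to the formulas of a sequent, and the others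
to its first formula. -/
def Sequent.subst (s : Sequent L) : Subst L :=
  assign fun n => s.formulas.getD n (s.formulas.head s.formulas_ne_nil)

/-- Equivariance must hold at every variable, including those beyond the length of the sequent. The
default is therefore a formula of the sequent, which a transforms along with the others; a fixed
default such as xₙ would fail. Nonemptiness of sequents supplies it. -/
theorem Sequent.subst_smul (a : Subst L) (s : Sequent L) : (a • s).subst = a * s.subst := by
  refine Subst.ext fun n => ?_
  rw [mul_smul, Sequent.subst, Sequent.subst, assign_smul_var, assign_smul_var]
  simp only [Sequent.formulas_smul, List.head_map]
  exact List.getD_map _ _ fun p => a • p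

/-- The sequent of pairwise distinct variables of the same type as the given one. -/
def Sequent.generic (s : Sequent L) : Sequent L where
  left := (List.range s.left.length).map Fm.var
  -- The shift matches the positions in `Sequent.formulas`, where the right side follows the left.
  right := (List.range s.right.length).map fun n => Fm.var (s.left.length + n)
  nonempty := by simpa using s.nonempty

theorem Sequent.type_generic (s : Sequent L) : s.generic.type = s.type := by
  simp [Sequent.type, Sequent.generic]

theorem Sequent.generic_smul (a : Subst L) (s : Sequent L) : (a • s).generic = s.generic := by
  have h1 : (a • s).left.length = s.left.length := congrArg Prod.fst (Sequent.type_smul a s)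
  have h2 : (a • s).right.length = s.right.length := congrArg Prod.snd (Sequent.type_smul a s)
  simp only [Sequent.generic, h1, h2]

theorem Sequent.subst_smul_generic (s : Sequent L) : s.subst • s.generic = s := by
  ext1
  · change ((List.range s.left.length).map Fm.var).map (fun p => s.subst • p) = s.left
    refine List.ext_getElem (by simp) fun n h1 h2 => ?_
    simp [Sequent.subst, Sequent.formulas, List.getD_eq_getElem?_getD, List.getElem?_append, h2]
  · change ((List.range s.right.length).map fun n => Fm.var (s.left.length + n)).map
      (fun p => s.subst • p) = s.right
    refine List.ext_getElem (by simp) fun n h1 h2 => ?_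
    simp [Sequent.subst, Sequent.formulas, List.getD_eq_getElem?_getD, List.getElem?_append, h2]

/-- The sequent of distinct variables as an element of a set of sequents closed under type. -/
def SequentSet.generic (S : SequentSet L) (s : S.Elem) : S.Elem :=
  ⟨s.1.generic, S.closed s.1 s.2 _ s.1.type_generic⟩

end Sequents

/-! ### Translations -/

section Translations

variable {L : PropLang.{u}} {L' : PropLang.{v}}

/-- Condition (iii) for a one-element set, tested on singletons. One direction says that h fixes
renamings, the other that nothing else is sent to them. -/
theorem IsTranslation.hom_eq_renameSubst_iff {h : Subst L →* Subst L'}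
    (hh : IsTranslation (powersetHom h)) (r : ℕ → ℕ) (a : Subst L) :
    h a = renameSubst L' r ↔ a = renameSubst L r := by
  have h1 : ({a} : Set (Subst L)) ∈ _ ↔ {a} ∈ _ := Set.ext_iff.1 (hh.variable_substs {r}) {a}
  simpa [powersetHom_apply] using h1

theorem IsTranslation.isIdempotentElem {h : Subst L →* Subst L'}
    (hh : IsTranslation (powersetHom h)) (a : Subst L) (ha : IsIdempotentElem (h a)) :
    IsIdempotentElem a := by
  have h1 := hh.idem {h a} (completelyJoinPrime_set_iff.2 ⟨_, rfl⟩)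
    (by rw [Set.singleton_mul_singleton, ha.eq]) {a} (completelyJoinPrime_set_iff.2 ⟨_, rfl⟩)
    (by rw [powersetHom_apply, Set.image_singleton])
  rw [Set.singleton_mul_singleton] at h1
  exact Set.singleton_injective h1

/-- An injective homomorphism of substitution monoids that fixes the variable substitutions
induces a translation. -/
theorem isTranslation_powersetHom {k : Subst L →* Subst L'} (hk : Function.Injective k)
    (hr : ∀ r, k (renameSubst L r) = renameSubst L' r) : IsTranslation (powersetHom k) where
  prime X hX := by
    obtain ⟨a, rfl⟩ := completelyJoinPrime_set_iff.1 hX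
    exact completelyJoinPrime_set_iff.2 ⟨k a, by rw [powersetHom_apply, Set.image_singleton]⟩
  idem Y _ hY X _ hXY := by
    subst hXY
    rw [powersetHom_apply, ← Set.image_mul] at hY
    exact hk.image_injective hY
  variable_substs R := by
    have h1 : renameSubst L' '' R = k '' (renameSubst L '' R) := by
      rw [Set.image_image]
      simp only [hr]
    ext X
    simp only [Set.mem_preimage, Set.mem_singleton_iff, powersetHom_apply, h1,
      hk.image_injective.eq_iff]

end Translations

theorem translationEquivalentVia_of_moduleIsomorphic {L : PropLang.{u}} {L' : PropLang.{v}}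
    (S : DeductiveSystem L) (T : DeductiveSystem L')
    (h : QuantaleHom (Set (Subst L)) (Set (Subst L')))
    (hh : IsTranslation h) (hsurj : Function.Surjective h)
    (H : ModuleIsomorphic (Set (Subst L)) S.theories (Restricted h T.theories)) :
    TranslationEquivalentVia S T h := by
  obtain ⟨h₀, rfl⟩ := exists_eq_powersetHom h hh.prime
  have hr : ∀ r, h₀ (renameSubst L r) = renameSubst L' r := fun r =>
    (hh.hom_eq_renameSubst_iff r _).2 rfl
  have hsurj₀ : Function.Surjective h₀ := fun b => by
    obtain ⟨X, hX⟩ := hsurj {b}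
    obtain ⟨a, -, ha⟩ : b ∈ h₀ '' X := hX.ge rfl
    exact ⟨a, ha⟩
  obtain ⟨k₀, hk⟩ := exists_section hr hh.isIdempotentElem hsurj₀
  -- A section is injective. It fixes renamings because h₀ maps the image of a renaming back to that
  -- renaming, whose only preimage is the renaming itself.
  refine ⟨h₀, k₀, rfl, isTranslation_powersetHom (Function.LeftInverse.injective hk)
    fun r => (hh.hom_eq_renameSubst_iff r _).1 (hk _), ?_⟩
  exact equivalentViaPair_of_moduleIsomorphic S.invariant T.invariant hk
    (fun u => u.1.subst) S.sequents.generic (fun _ _ => Sequent.subst_smul _ _)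
    (fun a u => Subtype.ext (Sequent.generic_smul a u.1))
    (fun u => Subtype.ext (Sequent.subst_smul_generic u.1))
    (fun u => u.1.subst) T.sequents.generic (fun _ _ => Sequent.subst_smul _ _)
    (fun a u => Subtype.ext (Sequent.generic_smul a u.1))
    (fun u => Subtype.ext (Sequent.subst_smul_generic u.1)) H

theorem EquivalentVia.moduleIsomorphic {L : PropLang.{u}} {L' : PropLang.{v}}
    {S : DeductiveSystem L} {T : DeductiveSystem L'}
    {h : QuantaleHom (Set (Subst L)) (Set (Subst L'))} (H : EquivalentVia S T h) :
    ModuleIsomorphic (Set (Subst L)) S.theories (Restricted h T.theories) := by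
  obtain ⟨h₀, k₀, rfl, H⟩ := H
  exact H.moduleIsomorphic S.invariant T.invariant

theorem TranslationEquivalentVia.equivalentVia {L : PropLang.{u}} {L' : PropLang.{v}}
    {S : DeductiveSystem L} {T : DeductiveSystem L'}
    {h : QuantaleHom (Set (Subst L)) (Set (Subst L'))} (H : TranslationEquivalentVia S T h) :
    EquivalentVia S T h := by
  obtain ⟨h₀, k₀, hh, -, H⟩ := H
  exact ⟨h₀, k₀, hh, H⟩

end PropLogic

theorem theorem7p3 {L : PropLang.{u}} {L' : PropLang.{v}}
    (S : DeductiveSystem L) (T : DeductiveSystem L')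
    (h : QuantaleHom (Set (Subst L)) (Set (Subst L')))
    (hh : IsTranslation h) (hsurj : Function.Surjective h) :
    (EquivalentVia S T h ↔
      ModuleIsomorphic (Set (Subst L)) S.theories (Restricted h T.theories)) ∧
    (TranslationEquivalentVia S T h ↔
      ModuleIsomorphic (Set (Subst L)) S.theories (Restricted h T.theories)) := by
  have hH := translationEquivalentVia_of_moduleIsomorphic S T h hh hsurj
  exact ⟨⟨fun H => H.moduleIsomorphic, fun H => (hH H).equivalentVia⟩,
    ⟨fun H => H.equivalentVia.moduleIsomorphic, hH⟩⟩
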